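/- Let $p$ be a prime, $n \ge 0$, $G = C_{p^n}$, and let $\mathcal{T} = \mathcal{O}_G$ be the orbit category (transitive $G$-sets and equivariant maps). For an orbit $V$, a finite $V$-set is a finite $G$-set over $V$; write $*_V = (V = V)$, and regard a map $U \to V$ of orbits as a $V$-set. A full $\mathcal{T}$-subcategory $\underline{\mathbb{F}}_I$ of finite $\mathcal{T}$-sets is a choice, for every orbit $V$, of an isomorphism-closed class $\mathbb{F}_{I,V}$ of finite $V$-sets, stable under restriction (pullback) along maps of orbits. It is a *weak indexing system* if $*_V \in \mathbb{F}_{I,V}$ whenever $\mathbb{F}_{I,V} \neq \emptyset$, and if it is closed under self-indexed coproducts: $\coprod_{U \in \mathrm{Orb}(S)} \mathrm{Ind}_U^V T_U \in \mathbb{F}_{I,V}$ whenever $S \in \mathbb{F}_{I,V}$ and $T_U \in \mathbb{F}_{I,U}$ for every orbit $U$ of $S$. It is *unital* if moreover every $\mathbb{F}_{I,V}$ is nonempty and $S \sqcup S' \in \mathbb{F}_{I,V}$ implies $S, S' \in \mathbb{F}_{I,V}$. Unital weak indexing systems are ordered by inclusion. For such $\underline{\mathbb{F}}_I$ let $\mathfrak{R}(\underline{\mathbb{F}}_I)$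 be the collection of maps $U \to V$ of orbits with $U \in \mathbb{F}_{I,V}$, and let $\nabla(\underline{\mathbb{F}}_I)$ be the collection of orbits $V$ with $2 \cdot *_V \in \mathbb{F}_{I,V}$. A *family* is a collection of orbits $\mathcal{F}$ such that $V \in \mathcal{F}$ whenever there is a map $V \to W$ with $W \in \mathcal{F}$. A *transfer system* $R$ is a wide subcategory of $\mathcal{O}_G$ containing all isomorphisms such that, for every commutative square of orbits $$\begin{array}{ccc} V' & \to & V \\ {\scriptstyle\alpha'}\downarrow & & \downarrow{\scriptstyle\alpha} \\ U' & \to & U \end{array}$$ for which $V' \to V \times_U U'$ is a summand inclusion, $\alpha \in R$ implies $\alpha' \in R$. Put $$\mathrm{Dom}(R) = \{U \mid \exists\, U \to V \xrightarrow{f} W,\ f \in R \text{ not an isomorphism}\},$$ $$\mathrm{Cod}(R) = \{U \mid \exists\, V \xrightarrow{f} W \leftarrow U,\ f \in R \text{ not an isomorphism}\}.$$ A *subgraph* of $R$ is a collection of maps in $R$; subgraphs are ordered by inclusion and form the poset $\mathrm{Sub}_{\mathrm{Graph}}(R)$. Let $\mathrm{Sv}(\underline{\mathbb{F}}_I)$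 be the subgraph of $\mathfrak{R}(\underline{\mathbb{F}}_I)$ consisting of the maps $U \to V$ with $V \in \mathrm{Cod}(\mathfrak{R}(\underline{\mathbb{F}}_I)) - \nabla(\underline{\mathbb{F}}_I)$ and $*_V \sqcup U \in \mathbb{F}_{I,V}$. For a collection of orbits $\mathcal{C}$, an *$R$-sieve on $\mathcal{C}$* is a subgraph $\mathfrak{S} \subset R$ consisting of non-isomorphisms such that (saying that an inclusion of subgroups $K \subset H$ lies in $\mathfrak S$ or $R$ when $[G/K] \to [G/H]$ does, and $H \in \mathcal{C}$ when $[G/H] \in \mathcal{C}$): (a) $\mathfrak{S}$ is closed under isomorphism of arrows; (b) if $K \subset H$ is in $\mathfrak{S}$, $L \subset H$ and $L \in \mathcal{C}$, then $L \cap K \subset L$ is in $\mathfrak{S}$; (c) if $K \subset H$ is in $\mathfrak{S}$, then $H \in \mathcal{C}$; (d) if $J \subset K$ is in $R$ and $K \subsetneq H$ is in $\mathfrak{S}$, then $J \subset H$ is in $\mathfrak{S}$. **Proposition.** Let $R$ be a transfer system and $\mathcal{F}$ a family for $\mathcal{O}_{C_{p^n}}$ with $\mathrm{Dom}(R) \subset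 \mathcal{F}$. Then the restriction of $\mathrm{Sv}$ to the poset $\mathfrak{R}^{-1}(R) \cap \nabla^{-1}(\mathcal{F})$ of unital weak indexing systems with transfer system $R$ and fold family $\mathcal{F}$, $$\mathrm{Sv}\colon \mathfrak{R}^{-1}(R) \cap \nabla^{-1}(\mathcal{F}) \longrightarrow \mathrm{Sub}_{\mathrm{Graph}}(R),$$ is an embedding of posets (injective, and $\mathrm{Sv}(\underline{\mathbb{F}}_I) \subset \mathrm{Sv}(\underline{\mathbb{F}}_J)$ if and only if $\underline{\mathbb{F}}_I \subset \underline{\mathbb{F}}_J$), and its image consists exactly of the $R$-sieves on $\mathrm{Cod}(R) - \mathcal{F}$. -/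

import Mathlib

universe u

open CategoryTheory

/-! ### The orbit category of a group -/

/-- A finite nonempty transitive `G`-set. -/
structure Orb (G : Type u) [Group G] where
  carrier : Type u
  [fin : Finite carrier]
  [act : MulAction G carrier]
  [transitive : MulAction.IsPretransitive G carrier]
  [nonempty : Nonempty carrier]

attribute [instance] Orb.fin Orb.act Orb.transitive Orb.nonempty

namespace Orb

variable {G : Type u} [Group G]

/-- The orbit category: morphisms are the `G`-equivariant maps. -/
instance : Category (Orb G) where
  Hom U V := U.carrier →[G] V.carrier
  id U := MulActionHom.id G
  comp f g := MulActionHom.comp g f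

/-- The `G`-equivariant map underlying a morphism of the orbit category. -/
def Hom.map {U V : Orb G} (f : U ⟶ V) : U.carrier →[G] V.carrier := f

/-- The orbit `[G/H]`. -/
def coset [Finite G] (H : Subgroup G) : Orb G where
  carrier := G ⧸ H

/-- The map `[G/K] ⟶ [G/H]`, `gK ↦ gH`, corresponding to an inclusion `K ≤ H`. -/
def proj [Finite G] {K H : Subgroup G} (h : K ≤ H) : coset K ⟶ coset H where
  toFun := Subgroup.quotientMapOfLE h
  map_smul' g x := by
    induction x using QuotientGroup.induction_on with
    | H a => rfl

end Orb

/-! ### Finite `V`-sets -/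

section VSets

variable {G : Type u} [Group G]

/-- A finite `V`-set: a finite `G`-set equipped with an equivariant map to the orbit `V`. -/
structure VSet (V : Orb G) where
  carrier : Type u
  [fin : Finite carrier]
  [act : MulAction G carrier]
  toBase : carrier →[G] V.carrier

attribute [instance] VSet.fin VSet.act

namespace VSet

variable {U V : Orb G}

/-- Two `V`-sets are isomorphic if there is an equivariant bijection over `V` between them. -/
def Isom (S T : VSet V) : Prop :=
  ∃ e : S.carrier →[G] T.carrier, Function.Bijective e ∧ ∀ s, T.toBase (e s) = S.toBase s

/-- A morphism `U ⟶ V` of orbits, regarded as a transitive `V`-set. -/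
def ofHom (f : U ⟶ V) : VSet V where
  carrier := U.carrier
  toBase := Orb.Hom.map f

/-- The terminal `V`-set `*_V`. -/
def terminal (V : Orb G) : VSet V := ofHom (𝟙 V)

/-- The disjoint union of a finite family of `V`-sets. -/
def coprod {ι : Type u} [Finite ι] (T : ι → VSet V) : VSet V where
  carrier := Σ i, (T i).carrier
  toBase :=
    { toFun := fun x => (T x.1).toBase x.2
      map_smul' := fun g x => map_smul (T x.1).toBase g x.2 }

/-- The disjoint union `S ⊔ T` of two `V`-sets. -/
def sum (S T : VSet V) : VSet V where
  carrier := S.carrier ⊕ T.carrier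
  toBase :=
    { toFun := Sum.elim S.toBase T.toBase
      map_smul' := by
        rintro g (x | x)
        · exact map_smul S.toBase g x
        · exact map_smul T.toBase g x }

/-- Restriction of a `V`-set along `f : U ⟶ V`, i.e. the pullback `S ×_V U` over `U`. -/
def res (f : U ⟶ V) (S : VSet V) : VSet U :=
  letI : MulAction G {x : S.carrier × U.carrier // S.toBase x.1 = Orb.Hom.map f x.2} :=
    { smul := fun g x => ⟨(g • x.1.1, g • x.1.2), by
        rw [map_smul S.toBase, map_smul (Orb.Hom.map f), x.2]⟩
      one_smul := fun x => Subtype.ext (one_smul G x.1)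
      mul_smul := fun g h x => Subtype.ext (mul_smul g h x.1) }
  { carrier := {x : S.carrier × U.carrier // S.toBase x.1 = Orb.Hom.map f x.2}
    toBase :=
      { toFun := fun x => x.1.2
        map_smul' := fun _ _ => rfl } }

/-- Induction of a `U`-set along `f : U ⟶ V`, i.e. postcomposition with `f`. -/
def ind (f : U ⟶ V) (T : VSet U) : VSet V where
  carrier := T.carrier
  toBase := (Orb.Hom.map f).comp T.toBase

/-- The set of orbits of a `V`-set. -/
abbrev Orbits (S : VSet V) : Type u := MulAction.orbitRel.Quotient G S.carrier

/-- An orbit of a `V`-set, as an object of the orbit category. -/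
def orbit (S : VSet V) (w : S.Orbits) : Orb G where
  carrier := w.orbit
  nonempty := by
    induction w using Quotient.inductionOn with
    | h a => exact ⟨⟨a, MulAction.mem_orbit_self a⟩⟩

/-- The structure map to `V` of an orbit of a `V`-set. -/
def orbitMap (S : VSet V) (w : S.Orbits) : S.orbit w ⟶ V where
  toFun x := S.toBase x.1
  map_smul' g x := map_smul S.toBase g x.1

/-- The `S`-indexed coproduct of a family `T_U`, where `U` runs over the orbits of `S`:
the disjoint union over `U` of the `V`-sets induced from the `T_U`. -/
def indexedCoprod (S : VSet V) (T : ∀ w : S.Orbits, VSet (S.orbit w)) : VSet V :=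
  haveI : Finite S.Orbits := Quotient.finite _
  coprod fun w => ind (S.orbitMap w) (T w)

end VSet

end VSets

/-! ### Weak indexing systems -/

/-- A full subcategory of the `𝒪_G`-category of finite `𝒪_G`-sets: an isomorphism-closed and
restriction-stable class of finite `V`-sets, for every orbit `V`. -/
@[ext]
structure FullSubsystem (G : Type u) [Group G] where
  sets : ∀ V : Orb G, Set (VSet V)
  isom_closed : ∀ {V : Orb G} {S T : VSet V}, S.Isom T → S ∈ sets V → T ∈ sets V
  res_closed : ∀ {U V : Orb G} (f : U ⟶ V) {S : VSet V}, S ∈ sets V → S.res f ∈ sets U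

namespace FullSubsystem

variable {G : Type u} [Group G]

/-- Full subcategories are ordered by inclusion. -/
instance : PartialOrder (FullSubsystem G) :=
  PartialOrder.lift FullSubsystem.sets fun _ _ h => FullSubsystem.ext h

/-- Weak indexing systems: full subcategories containing `*_V` whenever their value at `V` is
nonempty, and closed under self-indexed coproducts. -/
structure IsWeakIndexingSystem (I : FullSubsystem G) : Prop where
  terminal_mem : ∀ V : Orb G, (I.sets V).Nonempty → VSet.terminal V ∈ I.sets V
  indexedCoprod_mem : ∀ (V : Orb G) (S : VSet V) (T : ∀ w : S.Orbits, VSet (S.orbit w)),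
    S ∈ I.sets V → (∀ w, T w ∈ I.sets (S.orbit w)) → S.indexedCoprod T ∈ I.sets V

/-- Unital weak indexing systems: those having one color (every value is nonempty) and closed
under passing to summands. -/
structure IsUnital (I : FullSubsystem G) : Prop extends I.IsWeakIndexingSystem where
  nonempty : ∀ V : Orb G, (I.sets V).Nonempty
  summand_mem : ∀ (V : Orb G) (S S' : VSet V), S.sum S' ∈ I.sets V →
    S ∈ I.sets V ∧ S' ∈ I.sets V

/-- The transfers of `I`: the maps `U ⟶ V` of orbits which are, as `V`-sets, in `I`. -/
def transfers (I : FullSubsystem G) : MorphismProperty (Orb G) :=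
  fun _ V f => VSet.ofHom f ∈ I.sets V

/-- The fold family of `I`: the orbits `V` with `2 · *_V` in `I`. -/
def folds (I : FullSubsystem G) : ObjectProperty (Orb G) :=
  fun V => (VSet.terminal V).sum (VSet.terminal V) ∈ I.sets V

end FullSubsystem

/-! ### Transfer systems, families and sieves -/

section Sieves

variable {G : Type u} [Group G]

/-- A family of orbits: if `U ⟶ V` and `V` is in the family, so is `U`. -/
def IsFamily (F : ObjectProperty (Orb G)) : Prop :=
  ∀ ⦃U V : Orb G⦄, (U ⟶ V) → F V → F U

/-- (Orbital) transfer systems: wide subcategories of the orbit category which contain all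
isomorphisms and satisfy base change for the commutative squares for which `V' ⟶ V ×_U U'` is a
summand inclusion of finite `G`-sets, i.e. an injective map. -/
structure IsTransferSystem (R : MorphismProperty (Orb G)) : Prop where
  of_isIso : ∀ ⦃U V : Orb G⦄ (f : U ⟶ V), IsIso f → R f
  comp_mem : ∀ ⦃U V W : Orb G⦄ (f : U ⟶ V) (g : V ⟶ W), R f → R g → R (f ≫ g)
  base_change : ∀ ⦃V' V U' U : Orb G⦄ (a : V' ⟶ V) (f' : V' ⟶ U') (f : V ⟶ U) (b : U' ⟶ U),
    a ≫ f = f' ≫ b →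
    Function.Injective (fun x : V'.carrier => (Orb.Hom.map a x, Orb.Hom.map f' x)) →
    R f → R f'

/-- `Dom(R)`: the orbits mapping to the domain of a non-isomorphism in `R`. -/
def transferDom (R : MorphismProperty (Orb G)) : ObjectProperty (Orb G) :=
  fun U => ∃ (V W : Orb G) (_ : U ⟶ V) (f : V ⟶ W), R f ∧ ¬ IsIso f

/-- `Cod(R)`: the orbits mapping to the codomain of a non-isomorphism in `R`. -/
def transferCod (R : MorphismProperty (Orb G)) : ObjectProperty (Orb G) :=
  fun U => ∃ (V W : Orb G) (f : V ⟶ W) (_ : U ⟶ W), R f ∧ ¬ IsIso f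

/-- The collection of orbits `Cod(R) - F`. -/
def codDiff (R : MorphismProperty (Orb G)) (F : ObjectProperty (Orb G)) :
    ObjectProperty (Orb G) :=
  fun V => transferCod R V ∧ ¬ F V

/-- `R`-sieves on a collection `C` of orbits. A subgraph of `R` is a collection of maps in `R`. -/
structure IsRSieve [Finite G] (R : MorphismProperty (Orb G)) (C : ObjectProperty (Orb G))
    (S : MorphismProperty (Orb G)) : Prop where
  le : S ≤ R
  not_isIso : ∀ ⦃U V : Orb G⦄ (f : U ⟶ V), S f → ¬ IsIso f
  isom_closed : S.RespectsIso
  restrict : ∀ (K H L : Subgroup G) (hK : K ≤ H), L ≤ H → S (Orb.proj hK) → C (Orb.coset L) →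
    S (Orb.proj (inf_le_left : L ⊓ K ≤ L))
  cod_mem : ∀ (K H : Subgroup G) (hK : K ≤ H), S (Orb.proj hK) → C (Orb.coset H)
  precomp : ∀ (J K H : Subgroup G) (hJ : J ≤ K) (hK : K < H), R (Orb.proj hJ) →
    S (Orb.proj hK.le) → S (Orb.proj (hJ.trans hK.le))

namespace FullSubsystem

/-- `Sv(I)`: the maps `U ⟶ V` among the transfers of `I` for which `V` lies in the codomain family
but not in the fold family of `I`, and `*_V ⊔ U` is in `I`. -/
def sv (I : FullSubsystem G) : MorphismProperty (Orb G) :=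
  fun _ V f => I.transfers f ∧ codDiff I.transfers I.folds V ∧
    (VSet.terminal V).sum (VSet.ofHom f) ∈ I.sets V

/-- The poset of unital weak indexing systems with transfer system `R` and fold family `F`. -/
abbrev Fiber (R : MorphismProperty (Orb G)) (F : ObjectProperty (Orb G)) : Type (u + 1) :=
  {I : FullSubsystem G // I.IsUnital ∧ I.transfers = R ∧ I.folds = F}

/-- The poset of subgraphs of `R`. -/
abbrev SubGraph (R : MorphismProperty (Orb G)) : Type (u + 1) :=
  {S : MorphismProperty (Orb G) // S ≤ R}

/-- The restriction of `Sv` to the fiber over `R` and `F`. -/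
def svFiber (R : MorphismProperty (Orb G)) (F : ObjectProperty (Orb G)) (I : Fiber R F) :
    SubGraph R :=
  ⟨I.1.sv, fun _ _ _ h => I.2.2.1 ▸ h.1⟩

end FullSubsystem

end Sieves

/-! The point is an explicit description of every `I` in the fiber: a `V`-set lies in `I` exactly
when it satisfies `VSet.IsAdmissible` for `R`, `F` and `Sv(I)`. Membership in `I` is then monotone
in `Sv(I)`, which gives the order embedding and injectivity.

Necessity holds because `I` is closed under summands. For sufficiency
(`IsUnital.mem_of_isAdmissible`), if `V ∈ F` a set is assembled orbit by orbit from `2 · *_V`. If `V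
∉ F`, set aside one orbit isomorphic to `V`, should there be one. Subgroups of `C_{p^n}` form a
chain, so what remains, if nonempty, retracts over `V` onto an orbit `U` of largest stabilizer,
hence is induced from a `U`-set. Here `U ⟶ V` is a non-isomorphism in `R`, so `U ∈ Dom(R) ⊂ F` and
the first case applies over `U`. Inducing along `U` or along `*_V ⊔ U` recovers the set.

For the image, the sieve axioms for `Sv(I)` reflect the closure properties of `I`
(`IsUnital.isRSieve_sv`). Conversely, the admissible sets of any sieve form a unital weak indexing
system (`IsRSieve.isUnital_fullSubsystem`) with the prescribed `R`, `F` and `S`. The chain condition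
is needed only for sufficiency above. -/

theorem Subgroup.le_total_of_isCyclic_of_card_prime_pow {p n : ℕ} (hp : p.Prime) {G : Type*}
    [Group G] [Finite G] [IsCyclic G] (hG : Nat.card G = p ^ n) (H K : Subgroup G) :
    H ≤ K ∨ K ≤ H := by
  classical
  -- A cyclic group has at most `d` solutions of `x ^ d = 1`, so `B` is the full solution set for `d
  -- = |B|`, and it contains every `A` whose order divides `d`.
  have key : ∀ A B : Subgroup G, Nat.card A ∣ Nat.card B → A ≤ B := by
    intro A B hAB
    have := Fintype.ofFinite G
    let s : Finset G := Finset.univ.filter fun x => x ^ Nat.card B = 1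
    let t : Finset G := Finset.univ.filter fun x => x ∈ B
    have pow_card : ∀ (D : Subgroup G) (x : G), x ∈ D → x ^ Nat.card D = 1 := fun D x hx =>
      orderOf_dvd_iff_pow_eq_one.1 (D.orderOf_dvd_natCard hx)
    have hts : t ⊆ s := fun x hx =>
      Finset.mem_filter.2 ⟨Finset.mem_univ x, pow_card B x (Finset.mem_filter.1 hx).2⟩
    have ht : t.card = Nat.card B := by
      simp [t, Nat.card_eq_fintype_card, Fintype.card_subtype]
    have hs : s.card ≤ t.card := ht ▸ IsCyclic.card_pow_eq_one_le Nat.card_pos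
    have hst := Finset.eq_of_subset_of_card_le hts hs
    intro x hx
    have hxs : x ∈ s := by
      obtain ⟨c, hc⟩ := hAB
      exact Finset.mem_filter.2 ⟨Finset.mem_univ x, by rw [hc, pow_mul, pow_card A x hx, one_pow]⟩
    rw [← hst] at hxs
    simpa [t] using hxs
  obtain ⟨a, -, ha⟩ := (Nat.dvd_prime_pow hp).1 (hG ▸ H.card_subgroup_dvd_card)
  obtain ⟨b, -, hb⟩ := (Nat.dvd_prime_pow hp).1 (hG ▸ K.card_subgroup_dvd_card)
  rcases le_total a b with h | h
  · exact Or.inl (key _ _ (by rw [ha, hb]; exact pow_dvd_pow p h))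
  · exact Or.inr (key _ _ (by rw [ha, hb]; exact pow_dvd_pow p h))

/-! ### Orbits, their isomorphisms and coset models -/

namespace Orb

variable {G : Type u} [Group G]

/-- The morphism of orbits given by an equivariant map. -/
def homOfMap {U V : Orb G} (f : U.carrier →[G] V.carrier) : U ⟶ V := f

@[simp]
theorem map_comp_apply {U V W : Orb G} (f : U ⟶ V) (g : V ⟶ W) (x : U.carrier) :
    Hom.map (f ≫ g) x = Hom.map g (Hom.map f x) := rfl

@[simp]
theorem map_id_apply {U : Orb G} (x : U.carrier) : Hom.map (𝟙 U) x = x := rfl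

theorem hom_ext {U V : Orb G} {f g : U ⟶ V} (h : ∀ x, Hom.map f x = Hom.map g x) : f = g :=
  MulActionHom.ext h

theorem map_surjective {U V : Orb G} (f : U ⟶ V) : Function.Surjective (Hom.map f) := by
  intro v
  obtain ⟨u⟩ := U.nonempty
  obtain ⟨g, hg⟩ := MulAction.exists_smul_eq G (Hom.map f u) v
  exact ⟨g • u, by rw [map_smul, hg]⟩

/-- The inverse of a bijective equivariant map. -/
noncomputable def inverseOfBijective {α β : Type*} [MulAction G α] [MulAction G β]
    (f : α →[G] β) (hf : Function.Bijective f) : β →[G] α where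
  toFun := (Equiv.ofBijective f hf).symm
  map_smul' g b := by
    rw [Equiv.symm_apply_eq]
    simp [map_smul, Equiv.ofBijective_apply_symm_apply]

theorem apply_inverseOfBijective {α β : Type*} [MulAction G α] [MulAction G β]
    (f : α →[G] β) (hf : Function.Bijective f) (b : β) : f (inverseOfBijective f hf b) = b :=
  Equiv.ofBijective_apply_symm_apply f hf b

theorem inverseOfBijective_apply {α β : Type*} [MulAction G α] [MulAction G β]
    (f : α →[G] β) (hf : Function.Bijective f) (a : α) : inverseOfBijective f hf (f a) = a :=
  Equiv.ofBijective_symm_apply_apply f hf a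

theorem isIso_iff_bijective {U V : Orb G} (f : U ⟶ V) :
    IsIso f ↔ Function.Bijective (Hom.map f) := by
  constructor
  · intro h
    refine ⟨fun x y hxy => ?_, map_surjective f⟩
    have := congrArg (Hom.map (inv f)) hxy
    rwa [← map_comp_apply, ← map_comp_apply, IsIso.hom_inv_id] at this
  · intro h
    exact ⟨homOfMap (inverseOfBijective _ h),
      hom_ext (inverseOfBijective_apply _ h), hom_ext (apply_inverseOfBijective _ h)⟩

theorem map_inv_map {U V : Orb G} (f : U ⟶ V) [IsIso f] (x : U.carrier) :
    Hom.map (inv f) (Hom.map f x) = x := by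
  rw [← map_comp_apply, IsIso.hom_inv_id, map_id_apply]

theorem map_map_inv {U V : Orb G} (f : U ⟶ V) [IsIso f] (x : V.carrier) :
    Hom.map f (Hom.map (inv f) x) = x := by
  rw [← map_comp_apply, IsIso.inv_hom_id, map_id_apply]

theorem isIso_iff_injective {U V : Orb G} (f : U ⟶ V) :
    IsIso f ↔ Function.Injective (Hom.map f) := by
  rw [isIso_iff_bijective]
  exact ⟨fun h => h.1, fun h => ⟨h, map_surjective f⟩⟩

/-- The orbit of a point of a finite `G`-set. -/
def ofPoint {α : Type u} [MulAction G α] [Finite α] (a : α) : Orb G where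
  carrier := MulAction.orbit G a
  nonempty := ⟨⟨a, MulAction.mem_orbit_self a⟩⟩

/-- The inclusion of the orbit of a point. -/
def ofPointIncl {α : Type u} [MulAction G α] [Finite α] (a : α) :
    (ofPoint a : Orb G).carrier →[G] α where
  toFun x := x.1
  map_smul' _ _ := rfl

theorem ofPointIncl_injective {α : Type u} [MulAction G α] [Finite α] (a : α) :
    Function.Injective (ofPointIncl (G := G) a) := Subtype.val_injective

/-- A map from an orbit, corestricted to the orbit of the image of a point. -/
theorem exists_map_ofPoint {α : Type u} [MulAction G α] [Finite α] {U : Orb G}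
    (h : U.carrier →[G] α) (u : U.carrier) :
    ∃ k : U ⟶ ofPoint (G := G) (h u), ∀ x, ofPointIncl (h u) (Hom.map k x) = h x := by
  have hk : ∀ x, h x ∈ MulAction.orbit G (h u) := fun x => by
    obtain ⟨g, rfl⟩ := MulAction.exists_smul_eq G u x
    exact ⟨g, (map_smul h g u).symm⟩
  exact ⟨homOfMap { toFun := fun x => ⟨h x, hk x⟩
                    map_smul' := fun g x => Subtype.ext (map_smul h g x) }, fun _ => rfl⟩

/-- An orbit is isomorphic to the coset space of the stabilizer of any of its points. -/
noncomputable def cosetIso [Finite G] (U : Orb G) (u : U.carrier) :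
    coset (MulAction.stabilizer G u) ≅ U :=
  haveI : IsIso (homOfMap (U := coset (MulAction.stabilizer G u)) (V := U)
      { toFun := MulAction.ofQuotientStabilizer G u
        map_smul' := MulAction.ofQuotientStabilizer_smul G u }) := by
    rw [isIso_iff_injective]
    exact MulAction.injective_ofQuotientStabilizer G u
  asIso (homOfMap (U := coset (MulAction.stabilizer G u)) (V := U)
      { toFun := MulAction.ofQuotientStabilizer G u
        map_smul' := MulAction.ofQuotientStabilizer_smul G u })

theorem stabilizer_le_stabilizer_map {U V : Orb G} (f : U ⟶ V) (u : U.carrier) :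
    MulAction.stabilizer G u ≤ MulAction.stabilizer G (Hom.map f u) := by
  intro g hg
  rw [MulAction.mem_stabilizer_iff] at hg ⊢
  rw [← map_smul, hg]

/-- Every map of orbits is isomorphic to the projection of coset spaces given by the inclusion
of stabilizers. -/
theorem arrow_iso_proj [Finite G] {U V : Orb G} (f : U ⟶ V) (u : U.carrier) (v : V.carrier)
    (hv : Hom.map f u = v) (h : MulAction.stabilizer G u ≤ MulAction.stabilizer G v) :
    Nonempty (Arrow.mk (proj h) ≅ Arrow.mk f) := by
  subst hv
  refine ⟨Arrow.isoMk (cosetIso U u) (cosetIso V _) (hom_ext fun x => ?_)⟩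
  induction x using QuotientGroup.induction_on with
  | H a => exact map_smul (Hom.map f) a u

theorem prop_iff_proj [Finite G] (S : MorphismProperty (Orb G)) [S.RespectsIso] {U V : Orb G}
    (f : U ⟶ V) (u : U.carrier) (v : V.carrier)
    (hv : Hom.map f u = v) (h : MulAction.stabilizer G u ≤ MulAction.stabilizer G v) :
    S (proj h) ↔ S f :=
  S.arrow_mk_iso_iff (arrow_iso_proj f u v hv h).some

end Orb

/-! ### Transfer systems and sieves on arbitrary maps of orbits -/

namespace IsTransferSystem

variable {G : Type u} [Group G] {R : MorphismProperty (Orb G)}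

theorem respectsIso (hR : IsTransferSystem R) : R.RespectsIso :=
  MorphismProperty.RespectsIso.mk _ (fun _ _ hf => hR.comp_mem _ _ (hR.of_isIso _ inferInstance) hf)
    (fun _ _ hf => hR.comp_mem _ _ hf (hR.of_isIso _ inferInstance))

/-- The graph of `f` embeds `U` in the pullback `U ×_W V`, so `f` is a base change of `f ≫ g` along
`g`. -/
theorem of_comp (hR : IsTransferSystem R) {U V W : Orb G} (f : U ⟶ V) (g : V ⟶ W)
    (h : R (f ≫ g)) : R f :=
  hR.base_change (𝟙 U) f (f ≫ g) g (Category.id_comp _)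
    (fun _ _ hxy => (Prod.ext_iff.1 hxy).1) h

end IsTransferSystem

theorem codDiff_of_hom {G : Type u} [Group G] {R : MorphismProperty (Orb G)}
    {F : ObjectProperty (Orb G)} {U V : Orb G} (f : U ⟶ V) (hV : codDiff R F V) (hU : ¬ F U) :
    codDiff R F U := by
  obtain ⟨⟨A, B, g, b, hg⟩, -⟩ := hV
  exact ⟨⟨A, B, g, f ≫ b, hg⟩, hU⟩

namespace IsRSieve

variable {G : Type u} [Group G] [Finite G] {R : MorphismProperty (Orb G)}
  {F : ObjectProperty (Orb G)} {S : MorphismProperty (Orb G)}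

theorem codDiff_of_prop (hS : IsRSieve R (codDiff R F) S) (hF : IsFamily F) {U V : Orb G}
    (f : U ⟶ V) (hf : S f) : codDiff R F V := by
  have := hS.isom_closed
  obtain ⟨x⟩ := U.nonempty
  have h1 := (Orb.prop_iff_proj S f x _ rfl (Orb.stabilizer_le_stabilizer_map f _)).2 hf
  have h2 := hS.cod_mem _ _ _ h1
  exact codDiff_of_hom (Orb.cosetIso _ _).inv h2 fun h => h2.2 (hF (Orb.cosetIso _ _).hom h)

/-- Sieve axiom (b) without a choice of subgroups. After choosing a point of `V'`, injectivity into
the pullback says that its stabilizer is the intersection of the stabilizers of its two images. -/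
theorem base_change (hS : IsRSieve R (codDiff R F) S) (hF : IsFamily F) {V' V U' U : Orb G} (a : V' ⟶ V) (f' : V' ⟶ U')
    (f : V ⟶ U) (b : U' ⟶ U) (comm : a ≫ f = f' ≫ b)
    (inj : Function.Injective (fun x : V'.carrier => (Orb.Hom.map a x, Orb.Hom.map f' x)))
    (hf : S f) (hU' : ¬ F U') : S f' := by
  have := hS.isom_closed
  obtain ⟨x⟩ := V'.nonempty
  have hx : Orb.Hom.map b (Orb.Hom.map f' x) = Orb.Hom.map f (Orb.Hom.map a x) := by
    rw [← Orb.map_comp_apply, ← Orb.map_comp_apply, comm]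
  have hL : MulAction.stabilizer G (Orb.Hom.map f' x) ≤
      MulAction.stabilizer G (Orb.Hom.map f (Orb.Hom.map a x)) :=
    hx ▸ Orb.stabilizer_le_stabilizer_map b _
  have h1 := (Orb.prop_iff_proj S f (Orb.Hom.map a x) _ rfl
    (Orb.stabilizer_le_stabilizer_map f _)).2 hf
  have h2 := hS.restrict _ _ _ _ hL h1
    (codDiff_of_hom ((Orb.cosetIso _ _).hom ≫ b) (hS.codDiff_of_prop hF f hf)
      fun h => hU' (hF (Orb.cosetIso _ _).inv h))
  have hst : MulAction.stabilizer G (Orb.Hom.map f' x) ⊓ MulAction.stabilizer G (Orb.Hom.map a x) =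
      MulAction.stabilizer G x := by
    apply le_antisymm
    · rintro g ⟨hg, hg'⟩
      exact inj (Prod.ext ((map_smul (Orb.Hom.map a) g x).trans hg')
        ((map_smul (Orb.Hom.map f') g x).trans hg))
    · exact le_inf (Orb.stabilizer_le_stabilizer_map _ _) (Orb.stabilizer_le_stabilizer_map _ _)
  -- The inequality proofs are generalized so that the equality of subgroups can be rewritten inside
  -- the dependent `Orb.proj`.
  have h3 : S (Orb.proj (Orb.stabilizer_le_stabilizer_map f' x)) := by
    generalize_proofs h4 h5 at h2 ⊢
    revert h4 h5
    rw [hst]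
    exact fun _ h _ => h
  exact (Orb.prop_iff_proj S f' x _ rfl _).1 h3

/-- Sieve axiom (d) without a choice of subgroups. Strictness of the second inclusion is the fact
that sieve maps are not isomorphisms: with equal stabilizers, the fiber of `g` through the chosen
point is a singleton, and by transitivity so are all fibers. -/
theorem comp_mem (hS : IsRSieve R (codDiff R F) S) (hR : R.RespectsIso) {U V W : Orb G} (f : U ⟶ V)
    (g : V ⟶ W) (hf : R f) (hg : S g) : S (f ≫ g) := by
  have := hS.isom_closed
  obtain ⟨x⟩ := U.nonempty
  have hle := Orb.stabilizer_le_stabilizer_map g (Orb.Hom.map f x)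
  have hf' := (Orb.prop_iff_proj R f x _ rfl (Orb.stabilizer_le_stabilizer_map f _)).2 hf
  have hg' := (Orb.prop_iff_proj S g _ _ rfl hle).2 hg
  have hlt : MulAction.stabilizer G (Orb.Hom.map f x) <
      MulAction.stabilizer G (Orb.Hom.map g (Orb.Hom.map f x)) := by
    refine lt_of_le_not_ge hle fun hge => hS.not_isIso g hg ?_
    rw [Orb.isIso_iff_injective]
    have key : ∀ y, Orb.Hom.map g y = Orb.Hom.map g (Orb.Hom.map f x) → y = Orb.Hom.map f x := by
      intro y hy
      obtain ⟨k, rfl⟩ := MulAction.exists_smul_eq G (Orb.Hom.map f x) y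
      rw [map_smul] at hy
      exact hge hy
    intro y z hyz
    obtain ⟨k, rfl⟩ := MulAction.exists_smul_eq G (Orb.Hom.map f x) z
    rw [← inv_smul_eq_iff]
    apply key
    rw [map_smul, hyz, map_smul, inv_smul_smul]
  exact (Orb.prop_iff_proj S (f ≫ g) x _ rfl _).1 (hS.precomp _ _ _ _ hlt hf' hg')

end IsRSieve

/-! ### Splitting `V`-sets and retracting them onto an orbit -/

namespace VSet

variable {G : Type u} [Group G] {U V : Orb G}

theorem Isom.symm {S T : VSet V} (h : S.Isom T) : T.Isom S := by
  obtain ⟨e, he, hb⟩ := h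
  refine ⟨Orb.inverseOfBijective e he, (Equiv.ofBijective e he).symm.bijective, fun t => ?_⟩
  rw [← hb, Orb.apply_inverseOfBijective]

/-- The composite of an equivariant map from an orbit to a `V`-set with the structure map. -/
def along (X : VSet V) (j : U.carrier →[G] X.carrier) : U ⟶ V :=
  Orb.homOfMap (X.toBase.comp j)

@[simp]
theorem map_along (X : VSet V) (j : U.carrier →[G] X.carrier) (x : U.carrier) :
    Orb.Hom.map (X.along j) x = X.toBase (j x) := rfl

/-- The complement of the image of an equivariant map. -/
def remove (X : VSet V) {α : Type u} [MulAction G α] (j : α →[G] X.carrier) : VSet V :=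
  letI : MulAction G {x : X.carrier // x ∉ Set.range j} :=
    { smul := fun g x => ⟨g • x.1, by
        rintro ⟨a, ha⟩
        exact x.2 ⟨g⁻¹ • a, by rw [map_smul, ha, inv_smul_smul]⟩⟩
      one_smul := fun x => Subtype.ext (one_smul G x.1)
      mul_smul := fun g h x => Subtype.ext (mul_smul g h x.1) }
  { carrier := {x : X.carrier // x ∉ Set.range j}
    toBase :=
      { toFun := fun x => X.toBase x.1
        map_smul' := fun g x => map_smul X.toBase g x.1 } }

/-- The inclusion of the complement of the image of an equivariant map. -/
def removeIncl (X : VSet V) {α : Type u} [MulAction G α] (j : α →[G] X.carrier) :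
    (X.remove j).carrier →[G] X.carrier where
  toFun x := x.1
  map_smul' _ _ := rfl

theorem removeIncl_injective (X : VSet V) {α : Type u} [MulAction G α] (j : α →[G] X.carrier) :
    Function.Injective (X.removeIncl j) := Subtype.val_injective

theorem removeIncl_ne (X : VSet V) {α : Type u} [MulAction G α] (j : α →[G] X.carrier) (a : α)
    (x : (X.remove j).carrier) : j a ≠ X.removeIncl j x := fun h => x.2 ⟨a, h⟩

/-- The equivariant map out of a disjoint union. -/
def sumElim {S T : VSet V} {α : Type u} [MulAction G α] (a : S.carrier →[G] α)
    (b : T.carrier →[G] α) : (S.sum T).carrier →[G] α where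
  toFun := Sum.elim a b
  map_smul' := by
    rintro g (x | x)
    · exact map_smul a g x
    · exact map_smul b g x

theorem sumElim_injective {S T : VSet V} {α : Type u} [MulAction G α] {a : S.carrier →[G] α}
    {b : T.carrier →[G] α} (ha : Function.Injective a) (hb : Function.Injective b)
    (hab : ∀ x y, a x ≠ b y) : Function.Injective (sumElim a b) :=
  ha.sumElim hb hab

/-- The inclusion of the first summand. -/
def sumInl (S T : VSet V) : S.carrier →[G] (S.sum T).carrier where
  toFun := Sum.inl
  map_smul' _ _ := rfl

/-- The inclusion of the second summand. -/
def sumInr (S T : VSet V) : T.carrier →[G] (S.sum T).carrier where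
  toFun := Sum.inr
  map_smul' _ _ := rfl

theorem sum_remove_isom {X Y : VSet V} (j : Y.carrier →[G] X.carrier) (hj : Function.Injective j)
    (hb : ∀ y, X.toBase (j y) = Y.toBase y) : (Y.sum (X.remove j)).Isom X := by
  refine ⟨sumElim j (X.removeIncl j),
    ⟨sumElim_injective hj (X.removeIncl_injective j) (X.removeIncl_ne j), fun x => ?_⟩, ?_⟩
  · by_cases hx : x ∈ Set.range j
    · obtain ⟨y, rfl⟩ := hx
      exact ⟨Sum.inl y, rfl⟩
    · exact ⟨Sum.inr ⟨x, hx⟩, rfl⟩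
  · rintro (y | x)
    · exact hb y
    · rfl

/-- If the stabilizers of points of a nonempty `V`-set are totally ordered, then the `V`-set
retracts onto one of its orbits, compatibly with the maps to `V`. -/
theorem exists_map_ofPoint (hG : ∀ H K : Subgroup G, H ≤ K ∨ K ≤ H) (X : VSet V)
    [Nonempty X.carrier] :
    ∃ (x₁ : X.carrier) (q : X.carrier →[G] (Orb.ofPoint (G := G) x₁).carrier),
      ∀ x, Orb.Hom.map (X.along (Orb.ofPointIncl x₁)) (q x) = X.toBase x := by
  classical
  obtain ⟨v⟩ := V.nonempty
  -- Representatives are taken over one common point `v`, so that moving one to another preserves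
  -- the map to `V`.
  have hr : ∀ w : X.Orbits, ∃ x : X.carrier, X.toBase x = v ∧ Quotient.mk'' x = w := by
    intro w
    induction w using Quotient.inductionOn' with
    | h a =>
      obtain ⟨g, hg⟩ := MulAction.exists_smul_eq G (X.toBase a) v
      exact ⟨g • a, by rw [map_smul, hg], Quotient.sound' (MulAction.mem_orbit a g)⟩
  choose r hrv hrw using hr
  have hc : ∀ x : X.carrier, ∃ g : G, g • r (Quotient.mk'' x) = x := fun x =>
    Quotient.exact' (hrw (Quotient.mk'' x)).symm
  choose c hc using hc
  have : Finite X.Orbits := Quotient.finite _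
  have : Nonempty X.Orbits := ‹Nonempty X.carrier›.map Quotient.mk''
  obtain ⟨w₁, -, hw₁⟩ := Set.finite_univ.exists_maximalFor
    (fun w : X.Orbits => MulAction.stabilizer G (r w)) Set.univ Set.univ_nonempty
  have hmax : ∀ w, MulAction.stabilizer G (r w) ≤ MulAction.stabilizer G (r w₁) := fun w =>
    (hG _ _).elim id fun h => hw₁ (Set.mem_univ w) h
  -- The retraction sends `g • r w` to `g • r w₁`. The chosen `c` is not equivariant, but its
  -- ambiguity lies in the stabilizer of `r w`, which is contained in that of `r w₁` by maximality.
  refine ⟨r w₁, { toFun := fun x => ⟨c x • r w₁, MulAction.mem_orbit _ _⟩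
                  map_smul' := fun g x => Subtype.ext ?_ }, fun x => ?_⟩
  · have hw : (Quotient.mk'' (g • x) : X.Orbits) = Quotient.mk'' x :=
      Quotient.sound' (MulAction.mem_orbit x g)
    have h1 : c (g • x) • r (Quotient.mk'' x) = (g * c x) • r (Quotient.mk'' x) := by
      rw [mul_smul, hc x, ← hw, hc]
    have h2 : (g * c x)⁻¹ * c (g • x) ∈ MulAction.stabilizer G (r (Quotient.mk'' x)) := by
      rw [MulAction.mem_stabilizer_iff, mul_smul, h1, inv_smul_smul]
    have h3 := hmax _ h2
    rw [MulAction.mem_stabilizer_iff, mul_smul, inv_smul_eq_iff, mul_smul] at h3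
    exact h3
  · calc X.toBase (c x • r w₁) = X.toBase (c x • r (Quotient.mk'' x)) := by
          rw [map_smul, map_smul, hrv, hrv]
      _ = X.toBase x := by rw [hc]

end VSet

/-! ### Closure properties of weak indexing systems -/

namespace FullSubsystem

variable {G : Type u} [Group G] {I : FullSubsystem G}

/-- Induction along an isomorphism is restriction along its inverse. -/
theorem ind_mem_of_isIso {U V : Orb G} (e : U ⟶ V) [IsIso e] {X : VSet U} (hX : X ∈ I.sets U) :
    X.ind e ∈ I.sets V := by
  refine I.isom_closed ?_ (I.res_closed (inv e) hX)
  refine ⟨{ toFun := fun x => x.1.1, map_smul' := fun _ _ => rfl }, ⟨?_, fun x => ?_⟩, fun x => ?_⟩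
  · rintro ⟨⟨x, v⟩, h⟩ ⟨⟨x', v'⟩, h'⟩ (rfl : x = x')
    have : v = v' := by rw [← Orb.map_map_inv e v, ← Orb.map_map_inv e v', ← h, ← h']
    subst this
    rfl
  · exact ⟨⟨⟨x, Orb.Hom.map e (X.toBase x)⟩, (Orb.map_inv_map e _).symm⟩, rfl⟩
  · exact (congrArg (Orb.Hom.map e) x.2).trans (Orb.map_map_inv e _)

/-- A `V`-set fibered over a `V`-set `S` in `I`, with fibers over the orbits of `S` in `I`, is
in `I`. -/
theorem IsWeakIndexingSystem.mem_of_fibers (hI : I.IsWeakIndexingSystem) {V : Orb G}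
    {S Y : VSet V} (hS : S ∈ I.sets V) (q : Y.carrier →[G] S.carrier)
    (hq : ∀ y, S.toBase (q y) = Y.toBase y)
    (h : ∀ s : S.carrier, ∃ (U : Orb G) (φ : U.carrier →[G] S.carrier) (Z : VSet U)
      (j : Z.carrier →[G] Y.carrier), Z ∈ I.sets U ∧ Function.Injective φ ∧ s ∈ Set.range φ ∧
      Function.Injective j ∧ (∀ z, q (j z) = φ (Z.toBase z)) ∧
      ∀ y, q y ∈ Set.range φ → y ∈ Set.range j) : Y ∈ I.sets V := by
  let A : ∀ w : S.Orbits, MulAction G {y : Y.carrier // q y ∈ w.orbit} := fun w =>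
    { smul := fun g y => ⟨g • y.1, by
        rw [map_smul]
        exact (g • (⟨q y.1, y.2⟩ : w.orbit)).2⟩
      one_smul := fun x => Subtype.ext (one_smul G x.1)
      mul_smul := fun g h x => Subtype.ext (mul_smul g h x.1) }
  -- The part of `Y` over each orbit of `S`; `Y` is the `S`-indexed coproduct of these parts.
  let T : ∀ w : S.Orbits, VSet (S.orbit w) := fun w =>
    { carrier := {y : Y.carrier // q y ∈ w.orbit}
      act := A w
      toBase :=
        { toFun := fun y => ⟨q y.1, y.2⟩
          map_smul' := fun g y => Subtype.ext (map_smul q g y.1) } }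
  refine I.isom_closed ?_ (hI.indexedCoprod_mem V S T hS fun w => ?_)
  · refine ⟨{ toFun := fun x => x.2.1, map_smul' := fun _ _ => rfl }, ⟨?_, fun y => ?_⟩,
      fun y => (hq _).symm⟩
    · rintro ⟨w, y, hy⟩ ⟨w', y', hy'⟩ (rfl : y = y')
      obtain rfl : w = w' := by
        rw [MulAction.orbitRel.Quotient.mem_orbit] at hy hy'
        exact hy.symm.trans hy'
      rfl
    · exact ⟨⟨Quotient.mk'' (q y), y, MulAction.orbitRel.Quotient.mem_orbit.2 rfl⟩, rfl⟩
  · obtain ⟨⟨s, hs⟩⟩ := (S.orbit w).nonempty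
    obtain ⟨U, φ, Z, j, hZ, hφ, ⟨u, hu⟩, hj, hqj, hran⟩ := h s
    have hmem : ∀ x, φ x ∈ w.orbit := fun x => by
      obtain ⟨g, rfl⟩ := MulAction.exists_smul_eq G u x
      rw [map_smul, hu]
      exact (g • (⟨s, hs⟩ : w.orbit)).2
    -- The fiber is known only over a model `U` of the orbit; corestricting `φ` identifies the two.
    let e : U ⟶ S.orbit w := Orb.homOfMap
      { toFun := fun x => ⟨φ x, hmem x⟩
        map_smul' := fun g x => Subtype.ext (map_smul φ g x) }
    have he : IsIso e := (Orb.isIso_iff_injective e).2 fun x y hxy =>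
      hφ (Subtype.ext_iff.1 hxy)
    refine I.isom_closed ?_ (ind_mem_of_isIso e hZ)
    refine ⟨{ toFun := fun z => ⟨j z, (hqj z).symm ▸ hmem _⟩
              map_smul' := fun g z => Subtype.ext (map_smul j g z) },
      ⟨fun x y hxy => hj (Subtype.ext_iff.1 hxy), ?_⟩, fun z => Subtype.ext (hqj z)⟩
    rintro ⟨y, hy⟩
    obtain ⟨x, hx⟩ := Orb.map_surjective e ⟨q y, hy⟩
    obtain ⟨z, hz⟩ := hran y ⟨x, Subtype.ext_iff.1 hx⟩
    exact ⟨z, Subtype.ext hz⟩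

theorem IsWeakIndexingSystem.ind_mem (hI : I.IsWeakIndexingSystem) {U V : Orb G} (f : U ⟶ V)
    (hf : VSet.ofHom f ∈ I.sets V) {A : VSet U} (hA : A ∈ I.sets U) : A.ind f ∈ I.sets V :=
  hI.mem_of_fibers (Y := A.ind f) hf A.toBase (fun _ => rfl) fun s =>
    ⟨U, MulActionHom.id G, A, MulActionHom.id G, hA, Function.injective_id, ⟨s, rfl⟩,
      Function.injective_id, fun _ => rfl, fun y _ => ⟨y, rfl⟩⟩

theorem IsWeakIndexingSystem.ind_sum_ind_mem (hI : I.IsWeakIndexingSystem) {U U' V : Orb G}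
    (f : U ⟶ V) (g : U' ⟶ V) (hfg : (VSet.ofHom f).sum (VSet.ofHom g) ∈ I.sets V)
    {A : VSet U} {B : VSet U'} (hA : A ∈ I.sets U) (hB : B ∈ I.sets U') :
    (A.ind f).sum (B.ind g) ∈ I.sets V := by
  refine hI.mem_of_fibers (Y := (A.ind f).sum (B.ind g)) hfg
    (VSet.sumElim (S := A.ind f) (T := B.ind g)
      ((VSet.sumInl (VSet.ofHom f) (VSet.ofHom g)).comp A.toBase)
      ((VSet.sumInr (VSet.ofHom f) (VSet.ofHom g)).comp B.toBase)) ?_ ?_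
  · rintro (a | b) <;> rfl
  · rintro (u | u)
    · refine ⟨U, VSet.sumInl (VSet.ofHom f) (VSet.ofHom g), A, VSet.sumInl (A.ind f) (B.ind g), hA,
        Sum.inl_injective, ⟨u, rfl⟩, Sum.inl_injective, fun _ => rfl, ?_⟩
      rintro (a | b) ⟨y, hy⟩
      · exact ⟨a, rfl⟩
      · exact absurd hy Sum.inl_ne_inr
    · refine ⟨U', VSet.sumInr (VSet.ofHom f) (VSet.ofHom g), B, VSet.sumInr (A.ind f) (B.ind g), hB,
        Sum.inr_injective, ⟨u, rfl⟩, Sum.inr_injective, fun _ => rfl, ?_⟩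
      rintro (a | b) ⟨y, hy⟩
      · exact absurd hy Sum.inr_ne_inl
      · exact ⟨b, rfl⟩

theorem IsUnital.mem_of_injective (hI : I.IsUnital) {V : Orb G} {X Y : VSet V}
    (hX : X ∈ I.sets V) (j : Y.carrier →[G] X.carrier) (hj : Function.Injective j)
    (hb : ∀ y, X.toBase (j y) = Y.toBase y) : Y ∈ I.sets V :=
  (hI.summand_mem V _ _ (I.isom_closed (VSet.sum_remove_isom j hj hb).symm hX)).1

theorem IsUnital.terminal_mem' (hI : I.IsUnital) (V : Orb G) : VSet.terminal V ∈ I.sets V :=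
  hI.terminal_mem V (hI.nonempty V)

theorem IsUnital.mem_of_isEmpty (hI : I.IsUnital) {V : Orb G} (X : VSet V) [IsEmpty X.carrier] :
    X ∈ I.sets V :=
  hI.mem_of_injective (hI.terminal_mem' V) X.toBase (Function.injective_of_subsingleton _)
    fun _ => rfl

end FullSubsystem

/-! ### Admissible `V`-sets and the description of `I` -/

namespace VSet

variable {G : Type u} [Group G]

/-- The `V`-sets all of whose orbits are in `R`, and such that, if `V` is not in `F` and one of the
orbits is isomorphic to `V`, all the other orbits are in `S`. -/
def IsAdmissible (R : MorphismProperty (Orb G)) (F : ObjectProperty (Orb G))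
    (S : MorphismProperty (Orb G)) {V : Orb G} (X : VSet V) : Prop :=
  (∀ (U : Orb G) (j : U.carrier →[G] X.carrier), Function.Injective j → R (X.along j)) ∧
  (F V ∨ ∀ (U U' : Orb G) (j : U.carrier →[G] X.carrier) (j' : U'.carrier →[G] X.carrier),
    Function.Injective j → Function.Injective j' → (∀ x y, j x ≠ j' y) → IsIso (X.along j) →
    S (X.along j'))

theorem IsAdmissible.mono {R : MorphismProperty (Orb G)} {F : ObjectProperty (Orb G)}
    {S S' : MorphismProperty (Orb G)} (h : S ≤ S') {V : Orb G} {X : VSet V}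
    (hX : X.IsAdmissible R F S) : X.IsAdmissible R F S' :=
  ⟨hX.1, hX.2.imp_right fun h' U U' j j' hj hj' hd hi => h _ (h' U U' j j' hj hj' hd hi)⟩

theorem IsAdmissible.of_injective {R : MorphismProperty (Orb G)} {F : ObjectProperty (Orb G)}
    {S : MorphismProperty (Orb G)} {V : Orb G} {X Y : VSet V}
    (hX : X.IsAdmissible R F S) (i : Y.carrier →[G] X.carrier) (hi : Function.Injective i)
    (hb : ∀ y, X.toBase (i y) = Y.toBase y) : Y.IsAdmissible R F S := by
  have key : ∀ (U : Orb G) (j : U.carrier →[G] Y.carrier), Y.along j = X.along (i.comp j) :=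
    fun U j => Orb.hom_ext fun x => (hb (j x)).symm
  refine ⟨fun U j hj => ?_, hX.2.imp_right fun h U U' j j' hj hj' hd hiso => ?_⟩
  · rw [key]
    exact hX.1 U _ (hi.comp hj)
  · rw [key] at hiso ⊢
    exact h U U' _ _ (hi.comp hj) (hi.comp hj') (fun x y hxy => hd x y (hi hxy)) hiso

end VSet

namespace FullSubsystem

variable {G : Type u} [Group G] {I : FullSubsystem G}

theorem IsUnital.transfers_along (hI : I.IsUnital) {U V : Orb G} {X : VSet V} (hX : X ∈ I.sets V)
    (j : U.carrier →[G] X.carrier) (hj : Function.Injective j) : I.transfers (X.along j) :=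
  hI.mem_of_injective hX j hj fun _ => rfl

theorem IsUnital.folds_of_isIso (hI : I.IsUnital) {U V : Orb G} (f : U ⟶ V) [IsIso f]
    (h : (VSet.terminal V).sum (VSet.ofHom f) ∈ I.sets V) : I.folds V := by
  refine hI.mem_of_injective h (VSet.sumElim (S := VSet.terminal V) (T := VSet.terminal V)
    (VSet.sumInl (VSet.terminal V) (VSet.ofHom f))
    ((VSet.sumInr (VSet.terminal V) (VSet.ofHom f)).comp (Orb.Hom.map (inv f))))
    (VSet.sumElim_injective Sum.inl_injective (Sum.inr_injective.comp
      ((Orb.isIso_iff_injective (inv f)).1 inferInstance)) fun _ _ => Sum.inl_ne_inr) ?_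
  rintro (x | x)
  · rfl
  · exact Orb.map_map_inv f x

theorem IsUnital.not_isIso_of_sv (hI : I.IsUnital) {U V : Orb G} {f : U ⟶ V} (h : I.sv f) :
    ¬ IsIso f := fun _ => h.2.1.2 (hI.folds_of_isIso f h.2.2)

theorem IsUnital.isAdmissible (hI : I.IsUnital) {V : Orb G} {X : VSet V} (hX : X ∈ I.sets V) :
    X.IsAdmissible I.transfers I.folds I.sv := by
  refine ⟨fun U j hj => hI.transfers_along hX j hj, or_iff_not_imp_left.2 ?_⟩
  intro hV U U' j j' hj hj' hd hiso
  -- The orbit `j`, being isomorphic to `V`, supplies a copy of `*_V` disjoint from `j'`.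
  have hsum : (VSet.terminal V).sum (VSet.ofHom (X.along j')) ∈ I.sets V := by
    refine hI.mem_of_injective hX (VSet.sumElim (S := VSet.terminal V)
      (T := VSet.ofHom (X.along j')) (j.comp (Orb.Hom.map (inv (X.along j)))) j')
      (VSet.sumElim_injective (hj.comp ((Orb.isIso_iff_injective (inv (X.along j))).1
        inferInstance)) hj' fun x y => hd _ y) ?_
    rintro (x | x)
    · exact Orb.map_map_inv (X.along j) x
    · rfl
  have ht := hI.transfers_along hX j' hj'
  -- The map `X.along j'` itself witnesses `V ∈ Cod`: were it an isomorphism, `hsum` would put `V`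
  -- in the fold family.
  exact ⟨ht, ⟨⟨_, _, X.along j', 𝟙 V, ht, fun _ => hV (hI.folds_of_isIso _ hsum)⟩, hV⟩, hsum⟩

/-- Induction on cardinality: split off one orbit and substitute it and the complement for the two
points of `2 · *_V`. -/
theorem IsUnital.mem_of_folds (hI : I.IsUnital) {V : Orb G} (hV : I.folds V) (X : VSet V)
    (hX : ∀ (U : Orb G) (j : U.carrier →[G] X.carrier), Function.Injective j →
      I.transfers (X.along j)) : X ∈ I.sets V := by
  induction hn : Nat.card X.carrier using Nat.strong_induction_on generalizing X with
  | h n ih =>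
    rcases isEmpty_or_nonempty X.carrier with _ | ⟨⟨x⟩⟩
    · exact hI.mem_of_isEmpty X
    · let j := Orb.ofPointIncl (G := G) x
      have hj : Function.Injective j := Orb.ofPointIncl_injective x
      have hrem : X.remove j ∈ I.sets V := by
        refine ih (Nat.card (X.remove j).carrier) ?_ (X.remove j) (fun U i hi =>
          hX U ((X.removeIncl j).comp i) ((X.removeIncl_injective j).comp hi)) rfl
        rw [← hn]
        exact Finite.card_subtype_lt (x := x)
          (not_not.2 ⟨⟨x, MulAction.mem_orbit_self x⟩, rfl⟩)
      exact I.isom_closed (VSet.sum_remove_isom (Y := VSet.ofHom (X.along j)) j hj fun _ => rfl)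
        (hI.ind_sum_ind_mem (𝟙 V) (𝟙 V) hV (hX _ j hj) hrem)

theorem IsUnital.mem_of_isAdmissible (hG : ∀ H K : Subgroup G, H ≤ K ∨ K ≤ H) (hI : I.IsUnital)
    (hR : IsTransferSystem I.transfers) (hRF : transferDom I.transfers ≤ I.folds) {V : Orb G}
    {X : VSet V} (hX : X.IsAdmissible I.transfers I.folds I.sv) : X ∈ I.sets V := by
  by_cases hV : I.folds V
  · exact hI.mem_of_folds hV X hX.1
  have hX2 := hX.2.resolve_left hV
  -- An admissible `Y` over `V` that factors through a non-isomorphism `f : U ⟶ V` in `R` lies in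
  -- `I` as a `U`-set: `U ∈ Dom(R)` is a fold orbit, and left cancellation puts the orbits of `Y`
  -- over `U` in `R`.
  have fibered : ∀ {U : Orb G} (f : U ⟶ V) (Y : VSet V) (q : Y.carrier →[G] U.carrier),
      (∀ y, Orb.Hom.map f (q y) = Y.toBase y) → I.transfers f → ¬ IsIso f →
      Y.IsAdmissible I.transfers I.folds I.sv → ({ carrier := Y.carrier, toBase := q } : VSet U) ∈
        I.sets U := by
    intro U f Y q hq hf hiso hY
    refine hI.mem_of_folds (hRF _ ⟨_, _, 𝟙 U, f, hf, hiso⟩) _ fun W j hj => ?_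
    refine hR.of_comp _ f ?_
    convert hY.1 W j hj using 1
    exact Orb.hom_ext fun x => hq (j x)
  by_cases h : ∃ (U : Orb G) (j : U.carrier →[G] X.carrier), Function.Injective j ∧
    IsIso (X.along j)
  · obtain ⟨U, j, hj, hiso⟩ := h
    have hisom := VSet.sum_remove_isom (Y := VSet.ofHom (X.along j)) j hj fun _ => rfl
    have hU : VSet.ofHom (X.along j) ∈ I.sets V := hR.of_isIso _ hiso
    rcases isEmpty_or_nonempty (X.remove j).carrier with he | hne
    · refine I.isom_closed ⟨j, ⟨hj, fun x => ?_⟩, fun _ => rfl⟩ hU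
      by_contra hx
      exact he.false ⟨x, hx⟩
    · obtain ⟨x₁, q, hq⟩ := VSet.exists_map_ofPoint hG (X.remove j)
      -- The removed orbit is a copy of `V`, so admissibility puts the orbit receiving the
      -- retraction in `Sv(I)`. Hence `*_V ⊔ U ∈ I` can be used for an indexed coproduct.
      have hsv : I.sv ((X.remove j).along (Orb.ofPointIncl x₁)) :=
        hX2 U _ j ((X.removeIncl j).comp (Orb.ofPointIncl x₁)) hj
          ((X.removeIncl_injective j).comp (Orb.ofPointIncl_injective x₁))
          (fun x y => X.removeIncl_ne j x _) hiso
      have hB := fibered _ _ q hq hsv.1 (hI.not_isIso_of_sv hsv)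
        (hX.of_injective (X.removeIncl j) (X.removeIncl_injective j) fun _ => rfl)
      refine I.isom_closed hisom (I.isom_closed ?_ (hI.ind_sum_ind_mem (𝟙 V) _ hsv.2.2 hU hB))
      refine ⟨VSet.sumElim (VSet.sumInl _ _) (VSet.sumInr (VSet.ofHom (X.along j)) (X.remove j)),
        ⟨VSet.sumElim_injective Sum.inl_injective Sum.inr_injective fun _ _ => Sum.inl_ne_inr, ?_⟩,
        ?_⟩
      · rintro (x | x)
        · exact ⟨Sum.inl x, rfl⟩
        · exact ⟨Sum.inr x, rfl⟩
      · rintro (x | x)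
        · rfl
        · exact (hq x).symm
  · rcases isEmpty_or_nonempty X.carrier with he | hne
    · exact hI.mem_of_isEmpty X
    · obtain ⟨x₁, q, hq⟩ := VSet.exists_map_ofPoint hG X
      have hinj := Orb.ofPointIncl_injective (G := G) x₁
      have ht := hX.1 _ _ hinj
      have hB := fibered _ X q hq ht (fun hiso => h ⟨_, _, hinj, hiso⟩) hX
      refine I.isom_closed ?_ (hI.ind_mem _ ht hB)
      exact ⟨MulActionHom.id G, Function.bijective_id, fun x => (hq x).symm⟩

theorem IsUnital.mem_iff_isAdmissible (hG : ∀ H K : Subgroup G, H ≤ K ∨ K ≤ H) (hI : I.IsUnital)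
    (hR : IsTransferSystem I.transfers) (hRF : transferDom I.transfers ≤ I.folds) {V : Orb G}
    {X : VSet V} : X ∈ I.sets V ↔ X.IsAdmissible I.transfers I.folds I.sv :=
  ⟨hI.isAdmissible, hI.mem_of_isAdmissible hG hR hRF⟩

/-- Axiom (b) comes from restricting `*_H ⊔ [G/K]` to `L` and taking a summand; axiom (d) from an
indexed coproduct over `*_H ⊔ [G/K]`. -/
theorem IsUnital.isRSieve_sv [Finite G] (hI : I.IsUnital) (hR : IsTransferSystem I.transfers)
    (hF : IsFamily I.folds) : IsRSieve I.transfers (codDiff I.transfers I.folds) I.sv where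
  le _ _ _ h := h.1
  not_isIso _ _ _ h := hI.not_isIso_of_sv h
  isom_closed := by
    have := hR.respectsIso
    refine MorphismProperty.RespectsIso.mk _ (fun {U U' V} e f hf => ?_) fun {U V V'} e f hf => ?_
    · refine ⟨MorphismProperty.RespectsIso.precomp _ e.hom f hf.1, hf.2.1,
        hI.mem_of_injective hf.2.2
          (VSet.sumElim (T := VSet.ofHom (e.hom ≫ f)) (VSet.sumInl _ _)
            ((VSet.sumInr _ (VSet.ofHom f)).comp (Orb.Hom.map e.hom)))
          (VSet.sumElim_injective Sum.inl_injective (Sum.inr_injective.comp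
            ((Orb.isIso_iff_injective e.hom).1 inferInstance)) fun _ _ => Sum.inl_ne_inr) ?_⟩
      rintro (x | x) <;> rfl
    · refine ⟨MorphismProperty.RespectsIso.postcomp _ e.hom f hf.1,
        codDiff_of_hom e.inv hf.2.1 fun h => hf.2.1.2 (hF e.hom h),
        hI.mem_of_injective (ind_mem_of_isIso e.hom hf.2.2)
          (VSet.sumElim (T := VSet.ofHom (f ≫ e.hom))
            ((VSet.sumInl (VSet.terminal V) (VSet.ofHom f)).comp (Orb.Hom.map e.inv))
            (VSet.sumInr (VSet.terminal V) (VSet.ofHom f)))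
          (VSet.sumElim_injective (Sum.inl_injective.comp
            ((Orb.isIso_iff_injective e.inv).1 inferInstance)) Sum.inr_injective
            fun _ _ => Sum.inl_ne_inr) ?_⟩
      rintro (x | x)
      · exact congrArg (fun k => Orb.Hom.map k x) e.inv_hom_id
      · rfl
  restrict K H L hK hL hS hC := by
    let ι : Orb.coset (L ⊓ K) ⟶ Orb.coset K := Orb.proj inf_le_right
    let κ : Orb.coset (L ⊓ K) ⟶ Orb.coset L := Orb.proj inf_le_left
    have comm : ι ≫ Orb.proj hK = κ ≫ Orb.proj hL := Orb.hom_ext fun x => by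
      induction x using QuotientGroup.induction_on with
      | H a => rfl
    -- `[G/(L ∩ K)]` is the orbit of the pair of base cosets in the pullback.
    have inj : Function.Injective (fun x => (Orb.Hom.map ι x, Orb.Hom.map κ x)) := by
      intro x y h
      induction x using QuotientGroup.induction_on with
      | H a =>
        induction y using QuotientGroup.induction_on with
        | H b =>
          exact QuotientGroup.eq.2 ⟨QuotientGroup.eq.1 (Prod.ext_iff.1 h).2,
            QuotientGroup.eq.1 (Prod.ext_iff.1 h).1⟩
    refine ⟨hR.base_change ι κ _ _ comm inj hS.1, hC, hI.mem_of_injective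
      (I.res_closed (Orb.proj hL) hS.2.2)
      (VSet.sumElim (S := VSet.terminal (Orb.coset L)) (T := VSet.ofHom κ)
        { toFun := fun x => ⟨(Sum.inl (Orb.Hom.map (Orb.proj hL) x), x), rfl⟩
          map_smul' := fun g x => Subtype.ext (Prod.ext (congrArg Sum.inl
            (map_smul (Orb.Hom.map (Orb.proj hL)) g x)) rfl) }
        { toFun := fun x => ⟨(Sum.inr (Orb.Hom.map ι x), Orb.Hom.map κ x),
            congrArg (fun f => Orb.Hom.map f x) comm⟩
          map_smul' := fun g x => Subtype.ext (Prod.ext (congrArg Sum.inr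
            (map_smul (Orb.Hom.map ι) g x)) (map_smul (Orb.Hom.map κ) g x)) })
      (VSet.sumElim_injective (fun x y h => ?_) (fun x y h => ?_) fun x y h => ?_) ?_⟩
    · exact (Prod.ext_iff.1 (Subtype.ext_iff.1 h)).2
    · have h := Prod.ext_iff.1 (Subtype.ext_iff.1 h)
      exact inj (Prod.ext (Sum.inr_injective h.1) h.2)
    · exact Sum.inl_ne_inr (Prod.ext_iff.1 (Subtype.ext_iff.1 h)).1
    · rintro (x | x) <;> rfl
  cod_mem _ _ _ h := h.2.1
  precomp J K H hJ hK hRJ hS := by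
    have hcomp : Orb.proj (hJ.trans hK.le) = Orb.proj hJ ≫ Orb.proj hK.le :=
      Orb.hom_ext fun x => by
        induction x using QuotientGroup.induction_on with
        | H a => rfl
    rw [hcomp]
    exact ⟨hR.comp_mem _ _ hRJ hS.1, hS.2.1,
      hI.ind_sum_ind_mem (𝟙 _) _ hS.2.2 (hI.terminal_mem' _) hRJ⟩

end FullSubsystem

/-! ### Orbits of coproducts -/

namespace VSet

variable {G : Type u} [Group G]

theorem exists_lift_coprod {V : Orb G} {ι : Type u} [Finite ι] {T : ι → VSet V} {U : Orb G}
    (j : U.carrier →[G] (coprod T).carrier) :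
    ∃ (i : ι) (k : U.carrier →[G] (T i).carrier), ∀ x, j x = ⟨i, k x⟩ := by
  obtain ⟨u⟩ := U.nonempty
  have h : ∀ x, ∃ t, j x = ⟨(j u).1, t⟩ := fun x => by
    obtain ⟨g, rfl⟩ := MulAction.exists_smul_eq G u x
    exact ⟨g • (j u).2, map_smul j g u⟩
  choose k hk using h
  refine ⟨_, { toFun := k, map_smul' := fun g x => ?_ }, hk⟩
  have h1 : (⟨(j u).1, k (g • x)⟩ : Σ i, (T i).carrier) = ⟨(j u).1, g • k x⟩ := by
    rw [← hk]
    exact (map_smul j g x).trans (congrArg (g • ·) (hk x))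
  exact eq_of_heq (Sigma.mk.inj_iff.1 h1).2

theorem exists_sum_lift {V : Orb G} {X Y : VSet V} {U : Orb G}
    (j : U.carrier →[G] (X.sum Y).carrier) :
    (∃ k : U.carrier →[G] X.carrier, ∀ x, j x = Sum.inl (k x)) ∨
      ∃ k : U.carrier →[G] Y.carrier, ∀ x, j x = Sum.inr (k x) := by
  obtain ⟨u⟩ := U.nonempty
  rcases hu : j u with a | b
  · have h : ∀ x, ∃ t, j x = Sum.inl t := fun x => by
      obtain ⟨g, rfl⟩ := MulAction.exists_smul_eq G u x
      exact ⟨g • a, (map_smul j g u).trans (congrArg (g • ·) hu)⟩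
    choose k hk using h
    refine Or.inl ⟨{ toFun := k, map_smul' := fun g x => ?_ }, hk⟩
    exact Sum.inl_injective (β := Y.carrier)
      ((hk _).symm.trans ((map_smul j g x).trans (congrArg (g • ·) (hk x))))
  · have h : ∀ x, ∃ t, j x = Sum.inr t := fun x => by
      obtain ⟨g, rfl⟩ := MulAction.exists_smul_eq G u x
      exact ⟨g • b, (map_smul j g u).trans (congrArg (g • ·) hu)⟩
    choose k hk using h
    refine Or.inr ⟨{ toFun := k, map_smul' := fun g x => ?_ }, hk⟩
    exact Sum.inr_injective (α := X.carrier)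
      ((hk _).symm.trans ((map_smul j g x).trans (congrArg (g • ·) (hk x))))

variable {R : MorphismProperty (Orb G)} {F : ObjectProperty (Orb G)} {S : MorphismProperty (Orb G)}

theorem ofHom_isAdmissible_iff (hR : IsTransferSystem R) {U V : Orb G} (f : U ⟶ V) :
    (ofHom f).IsAdmissible R F S ↔ R f := by
  refine ⟨fun h => h.1 U (MulActionHom.id G) Function.injective_id, fun h => ⟨fun W j hj => ?_,
    Or.inr fun W W' j j' hj hj' hd _ => ?_⟩⟩
  · have : IsIso (Orb.homOfMap (U := W) (V := U) j) := (Orb.isIso_iff_injective _).2 hj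
    exact hR.comp_mem (Orb.homOfMap (U := W) (V := U) j) f (hR.of_isIso _ this) h
  -- A transitive set has no two disjoint orbits, so the second condition is vacuous.
  · obtain ⟨y⟩ := W'.nonempty
    obtain ⟨x, hx⟩ := Orb.map_surjective (Orb.homOfMap (U := W) (V := U) j) (j' y)
    exact absurd hx (hd x y)

theorem prop_of_terminal_sum_isAdmissible {U V : Orb G} (f : U ⟶ V) (hV : ¬ F V)
    (h : ((terminal V).sum (ofHom f)).IsAdmissible R F S) : S f :=
  h.2.resolve_left hV V U (sumInl (terminal V) (ofHom f))
    (sumInr (terminal V) (ofHom f)) Sum.inl_injective Sum.inr_injective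
    (fun _ _ => Sum.inl_ne_inr) (inferInstanceAs (IsIso (𝟙 V)))

end VSet

/-! ### The weak indexing system of a sieve -/

namespace IsRSieve

variable {G : Type u} [Group G] [Finite G] {R : MorphismProperty (Orb G)}
  {F : ObjectProperty (Orb G)} {S : MorphismProperty (Orb G)}

/-- Each orbit of the restriction is a base change of an orbit of `X`, so `R` and, away from `F`,
`S` are inherited. What needs `Dom(R) ⊂ F` is that a copy of `U` in the restriction comes from a
copy of `V` in `X`. -/
theorem res_isAdmissible (hS : IsRSieve R (codDiff R F) S) (hR : IsTransferSystem R)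
    (hF : IsFamily F) (hRF : transferDom R ≤ F) {U V : Orb G} (f : U ⟶ V) {X : VSet V}
    (hX : X.IsAdmissible R F S) : (X.res f).IsAdmissible R F S := by
  let π : (X.res f).carrier →[G] X.carrier :=
    { toFun := fun x => x.1.1, map_smul' := fun _ _ => rfl }
  have hπ : ∀ y, X.toBase (π y) = Orb.Hom.map f ((X.res f).toBase y) := fun y => y.2
  have hinj : ∀ y z, π y = π z → (X.res f).toBase y = (X.res f).toBase z → y = z :=
    fun y z h h' => Subtype.ext (Prod.ext h h')
  have square : ∀ (W : Orb G) (j : W.carrier →[G] (X.res f).carrier), Function.Injective j →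
      ∀ w : W.carrier, ∃ a : W ⟶ Orb.ofPoint (π (j w)),
        (∀ x, Orb.ofPointIncl (π (j w)) (Orb.Hom.map a x) = π (j x)) ∧
        a ≫ X.along (Orb.ofPointIncl (π (j w))) = (X.res f).along j ≫ f ∧
        Function.Injective fun x => (Orb.Hom.map a x, Orb.Hom.map ((X.res f).along j) x) := by
    intro W j hj w
    obtain ⟨a, ha⟩ := Orb.exists_map_ofPoint (π.comp j) w
    refine ⟨a, ha, Orb.hom_ext fun x => ?_, fun x y h => hj (hinj _ _ ?_ (Prod.ext_iff.1 h).2)⟩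
    · exact (congrArg X.toBase (ha x)).trans (hπ (j x))
    · exact (ha x).symm.trans ((congrArg _ (Prod.ext_iff.1 h).1).trans (ha y))
  refine ⟨fun W j hj => ?_, or_iff_not_imp_left.2 fun hU W W' j j' hj hj' hd hiso => ?_⟩
  · obtain ⟨w⟩ := W.nonempty
    obtain ⟨a, -, comm, inj⟩ := square W j hj w
    exact hR.base_change a _ _ f comm inj (hX.1 _ _ (Orb.ofPointIncl_injective _))
  · obtain ⟨w⟩ := W.nonempty
    obtain ⟨w'⟩ := W'.nonempty
    obtain ⟨a, ha, comm, inj⟩ := square W j hj w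
    obtain ⟨a', ha', comm', inj'⟩ := square W' j' hj' w'
    have hX2 := hX.2.resolve_left fun hV => hU (hF f hV)
    -- Otherwise `U` would map to the domain of a non-isomorphism in `R`, and so lie in `F`.
    have hiso' : IsIso (X.along (Orb.ofPointIncl (π (j w)))) := by
      by_contra hn
      exact hU (hRF _ ⟨_, _, inv ((X.res f).along j) ≫ a, _,
        hX.1 _ _ (Orb.ofPointIncl_injective _), hn⟩)
    refine hS.base_change hF a' _ _ f comm' inj' (hX2 _ _ _ _ (Orb.ofPointIncl_injective _)
      (Orb.ofPointIncl_injective _) (fun x y hxy => ?_) hiso') hU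
    -- If the two orbits of `X` met, they would be the same copy of `V`. A point of `j` over the
    -- same point of `U` as `j' y` would then agree with `j' y`, contradicting disjointness.
    obtain ⟨y, rfl⟩ := Orb.map_surjective a' y
    obtain ⟨x, hx⟩ := Orb.map_surjective ((X.res f).along j) ((X.res f).toBase (j' y))
    refine hd x y (hinj _ _ ?_ hx)
    have h1 : X.toBase (π (j x)) = X.toBase (π (j' y)) := by
      rw [hπ, hπ]
      exact congrArg _ hx
    rw [← ha', ← hxy, ← ha] at h1 ⊢
    exact congrArg _ ((Orb.isIso_iff_injective _).1 hiso' h1)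

/-- The full subsystem determined by a transfer system, a family and a sieve. -/
def fullSubsystem (hS : IsRSieve R (codDiff R F) S) (hR : IsTransferSystem R)
    (hF : IsFamily F) (hRF : transferDom R ≤ F) : FullSubsystem G where
  sets V := {X | X.IsAdmissible R F S}
  isom_closed h hX := by
    obtain ⟨i, hi, hb⟩ := h.symm
    exact hX.of_injective i hi.1 hb
  res_closed f _ hX := hS.res_isAdmissible hR hF hRF f hX

theorem terminal_sum_ofHom_isAdmissible (hS : IsRSieve R (codDiff R F) S)
    (hR : IsTransferSystem R) {U V : Orb G} (f : U ⟶ V) (hf : R f) (h : F V ∨ S f) :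
    ((VSet.terminal V).sum (VSet.ofHom f)).IsAdmissible R F S := by
  have := hS.isom_closed
  have hid : R (𝟙 V) := hR.of_isIso _ inferInstance
  have lift : ∀ (W : Orb G) (j : W.carrier →[G] ((VSet.terminal V).sum (VSet.ofHom f)).carrier),
      Function.Injective j →
      (∃ e : W ⟶ V, IsIso e ∧ (∀ x, j x = Sum.inl (Orb.Hom.map e x)) ∧
        ((VSet.terminal V).sum (VSet.ofHom f)).along j = e) ∨
      (∃ e : W ⟶ U, IsIso e ∧ (∀ x, j x = Sum.inr (Orb.Hom.map e x)) ∧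
        ((VSet.terminal V).sum (VSet.ofHom f)).along j = e ≫ f) := by
    intro W j hj
    rcases VSet.exists_sum_lift j with ⟨k, hk⟩ | ⟨k, hk⟩
    · refine Or.inl ⟨Orb.homOfMap (V := V) k, (Orb.isIso_iff_injective _).2 fun x y hxy =>
        hj ?_, hk, Orb.hom_ext fun x => ?_⟩
      · rw [hk, hk]
        exact congrArg Sum.inl hxy
      · rw [VSet.map_along, hk]
        rfl
    · refine Or.inr ⟨Orb.homOfMap (V := U) k, (Orb.isIso_iff_injective _).2 fun x y hxy =>
        hj ?_, hk, Orb.hom_ext fun x => ?_⟩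
      · rw [hk, hk]
        exact congrArg Sum.inr hxy
      · rw [VSet.map_along, hk]
        rfl
  refine ⟨fun W j hj => ?_, h.imp_right fun h W W' j j' hj hj' hd hiso => ?_⟩
  · rcases lift W j hj with ⟨e, he, -, heq⟩ | ⟨e, he, -, heq⟩
    · rw [heq]
      exact hR.of_isIso _ he
    · rw [heq]
      exact hR.comp_mem _ _ (hR.of_isIso _ he) hf
  · rcases lift W j hj with ⟨e, he, hj, heq⟩ | ⟨e, he, hj, heq⟩
    · rcases lift W' j' hj' with ⟨e', he', hj', heq'⟩ | ⟨e', he', hj', heq'⟩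
      · obtain ⟨y⟩ := W'.nonempty
        obtain ⟨x, hx⟩ := Orb.map_surjective e (Orb.Hom.map e' y)
        exact absurd (by rw [hj, hj', hx]) (hd x y)
      · rw [heq']
        exact MorphismProperty.RespectsIso.precomp _ e' f h
    -- The copy of `V` cannot be the second summand, since sieve maps are not isomorphisms.
    · rw [heq] at hiso
      exact absurd (IsIso.of_isIso_comp_left e f) (hS.not_isIso f h)

/-- An orbit isomorphic to `V` forces both `W ⟶ X.orbit w` and `X.orbit w ⟶ V` to be isomorphisms.
Another orbit over the same `w` is controlled by admissibility of `T w`; one over `w' ≠ w` factors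
through a sieve map of `X`, and axiom (d) applies. -/
theorem indexedCoprod_isAdmissible (hS : IsRSieve R (codDiff R F) S) (hR : IsTransferSystem R)
    {V : Orb G} {X : VSet V} {T : ∀ w : X.Orbits, VSet (X.orbit w)}
    (hF : IsFamily F)
    (hX : X.IsAdmissible R F S) (hT : ∀ w, (T w).IsAdmissible R F S) :
    (X.indexedCoprod T).IsAdmissible R F S := by
  have := hS.isom_closed
  have : Finite X.Orbits := Quotient.finite _
  let i : ∀ w : X.Orbits, (X.orbit w).carrier →[G] X.carrier := fun w =>
    { toFun := fun x => x.1, map_smul' := fun _ _ => rfl }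
  have hi : ∀ w, Function.Injective (i w) := fun w => Subtype.val_injective
  have hRi : ∀ w, R (X.orbitMap w) := fun w => hX.1 _ (i w) (hi w)
  have lift : ∀ (W : Orb G) (j : W.carrier →[G] (X.indexedCoprod T).carrier),
      Function.Injective j → ∃ (w : X.Orbits) (k : W.carrier →[G] (T w).carrier),
        Function.Injective k ∧ (∀ x, j x = ⟨w, k x⟩) ∧
        (X.indexedCoprod T).along j = (T w).along k ≫ X.orbitMap w := by
    intro W j hj
    obtain ⟨w, k, hk⟩ := VSet.exists_lift_coprod j
    refine ⟨w, k, fun x y hxy => hj ?_, hk, Orb.hom_ext fun x => ?_⟩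
    · exact (hk x).trans ((congrArg (Sigma.mk w) hxy).trans (hk y).symm)
    · exact congrArg (X.indexedCoprod T).toBase (hk x)
  refine ⟨fun W j hj => ?_, or_iff_not_imp_left.2 fun hV W W' j j' hj hj' hd hiso => ?_⟩
  · obtain ⟨w, k, hk, -, heq⟩ := lift W j hj
    rw [heq]
    exact hR.comp_mem _ _ ((hT w).1 W k hk) (hRi w)
  · obtain ⟨w, k, hk, hjk, heq⟩ := lift W j hj
    obtain ⟨w', k', hk', hjk', heq'⟩ := lift W' j' hj'
    rw [heq] at hiso
    have h1 : IsIso ((T w).along k) := by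
      rw [Orb.isIso_iff_injective] at hiso ⊢
      exact Function.Injective.of_comp (f := Orb.Hom.map (X.orbitMap w)) hiso
    have h2 : IsIso (X.orbitMap w) := IsIso.of_isIso_comp_left ((T w).along k) _
    rw [heq']
    by_cases hw : w = w'
    · subst hw
      refine MorphismProperty.RespectsIso.postcomp _ (X.orbitMap w) _
        ((hT w).2.resolve_left (fun h => hV (hF (inv (X.orbitMap w)) h)) W W' k k' hk hk'
          (fun x y hxy => hd x y ?_) h1)
      rw [hjk, hjk', hxy]
    · refine hS.comp_mem hR.respectsIso _ _ ((hT w').1 W' k' hk')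
        (hX.2.resolve_left hV _ _ (i w) (i w') (hi w) (hi w') (fun x y hxy => hw ?_) h2)
      have hx := MulAction.orbitRel.Quotient.mem_orbit.1 x.2
      have hy := MulAction.orbitRel.Quotient.mem_orbit.1 y.2
      rw [← hx, ← hy]
      exact congrArg Quotient.mk'' hxy

theorem isUnital_fullSubsystem (hS : IsRSieve R (codDiff R F) S) (hR : IsTransferSystem R)
    (hF : IsFamily F) (hRF : transferDom R ≤ F) : (hS.fullSubsystem hR hF hRF).IsUnital where
  terminal_mem V _ := (VSet.ofHom_isAdmissible_iff hR (𝟙 V)).2 (hR.of_isIso _ inferInstance)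
  nonempty V := ⟨_, (VSet.ofHom_isAdmissible_iff hR (𝟙 V)).2 (hR.of_isIso _ inferInstance)⟩
  indexedCoprod_mem _ _ _ hX hT := hS.indexedCoprod_isAdmissible hR hF hX hT
  summand_mem _ X Y h := ⟨h.of_injective (VSet.sumInl X Y) Sum.inl_injective fun _ => rfl,
    h.of_injective (VSet.sumInr X Y) Sum.inr_injective fun _ => rfl⟩

theorem transfers_fullSubsystem (hS : IsRSieve R (codDiff R F) S) (hR : IsTransferSystem R)
    (hF : IsFamily F) (hRF : transferDom R ≤ F) :
    (hS.fullSubsystem hR hF hRF).transfers = R := by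
  ext U V f
  exact VSet.ofHom_isAdmissible_iff hR f

theorem folds_fullSubsystem (hS : IsRSieve R (codDiff R F) S) (hR : IsTransferSystem R)
    (hF : IsFamily F) (hRF : transferDom R ≤ F) : (hS.fullSubsystem hR hF hRF).folds = F := by
  ext V
  refine ⟨fun h => ?_, fun h => hS.terminal_sum_ofHom_isAdmissible hR (𝟙 V)
    (hR.of_isIso _ inferInstance) (Or.inl h)⟩
  -- Outside `F`, admissibility of `2 · *_V` would put an identity in the sieve.
  by_contra hV
  exact hS.not_isIso (𝟙 V) (VSet.prop_of_terminal_sum_isAdmissible (𝟙 V) hV h) inferInstance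

theorem sv_fullSubsystem (hS : IsRSieve R (codDiff R F) S) (hR : IsTransferSystem R)
    (hF : IsFamily F) (hRF : transferDom R ≤ F) : (hS.fullSubsystem hR hF hRF).sv = S := by
  ext U V f
  unfold FullSubsystem.sv
  rw [transfers_fullSubsystem, folds_fullSubsystem]
  exact ⟨fun h => VSet.prop_of_terminal_sum_isAdmissible f h.2.1.2 h.2.2, fun h => ⟨hS.le _ h,
    hS.codDiff_of_prop hF f h, hS.terminal_sum_ofHom_isAdmissible hR f (hS.le _ h) (Or.inr h)⟩⟩

end IsRSieve

theorem mainTheorem4 (p n : ℕ) (hp : p.Prime) (G : Type u) [Group G] [Finite G] [IsCyclic G]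
    (hG : Nat.card G = p ^ n) (R : MorphismProperty (Orb G)) (hR : IsTransferSystem R)
    (F : ObjectProperty (Orb G)) (hF : IsFamily F) (hRF : transferDom R ≤ F) :
    Function.Injective (FullSubsystem.svFiber R F) ∧
    (∀ I J : FullSubsystem.Fiber R F,
      FullSubsystem.svFiber R F I ≤ FullSubsystem.svFiber R F J ↔ I ≤ J) ∧
    Set.range (FullSubsystem.svFiber R F) =
      {S : FullSubsystem.SubGraph R | IsRSieve R (codDiff R F) S.1} := by
  have hchain := Subgroup.le_total_of_isCyclic_of_card_prime_pow hp hG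
  have mem_iff : ∀ (I : FullSubsystem.Fiber R F) {V : Orb G} {X : VSet V},
      X ∈ I.1.sets V ↔ X.IsAdmissible R F I.1.sv := by
    rintro ⟨I, hI, rfl, rfl⟩ V X
    exact hI.mem_iff_isAdmissible hchain hR hRF
  have embedding : ∀ I J : FullSubsystem.Fiber R F,
      FullSubsystem.svFiber R F I ≤ FullSubsystem.svFiber R F J ↔ I ≤ J := by
    refine fun I J => ⟨fun h V X hX => (mem_iff J).2 (((mem_iff I).1 hX).mono h), ?_⟩
    intro h U V f hf
    have hC : codDiff I.1.transfers I.1.folds = codDiff J.1.transfers J.1.folds :=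
      congrArg₂ codDiff (I.2.2.1.trans J.2.2.1.symm) (I.2.2.2.trans J.2.2.2.symm)
    exact ⟨h V hf.1, hC ▸ hf.2.1, h V hf.2.2⟩
  refine ⟨fun I J h => le_antisymm ((embedding I J).1 h.le) ((embedding J I).1 h.ge), embedding, ?_⟩
  ext S
  constructor
  · rintro ⟨⟨I, hI, rfl, rfl⟩, rfl⟩
    exact hI.isRSieve_sv hR hF
  · intro hS
    exact ⟨⟨IsRSieve.fullSubsystem hS hR hF hRF, IsRSieve.isUnital_fullSubsystem hS hR hF hRF,
      IsRSieve.transfers_fullSubsystem hS hR hF hRF, IsRSieve.folds_fullSubsystem hS hR hF hRF⟩,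
      Subtype.ext (IsRSieve.sv_fullSubsystem hS hR hF hRF)⟩
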